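/- Let $p$ be a unit price and $c$ a unit cost with $0<c<p$, let $\kappa=\frac{p-c}{p}\in(0,1)$ be the profit margin, and let $\mu>0$, $\sigma\ge 0$. For an order quantity $q\ge 0$ and a demand $v\ge 0$ let $\pi(q,v)=p\min\{q,v\}-cq$. Let $\mathcal P$ be the set of probability measures on $\mathbb R_+=[0,\infty)$ and let $$\mathcal A=\{G\in\mathcal P:\ \mathbb E_G[\tilde v]=\mu,\ \mathbb E_G[\tilde v^2]=\mu^2+\sigma^2\}.$$ For $F,G\in\mathcal P$ let $d_{\rm OT}(F,G)=\inf_\Gamma\int|u-v|^2\,{\rm d}\Gamma(u,v)\in[0,\infty]$, the infimum being over all probability measures $\Gamma$ on $\mathbb R_+\times\mathbb R_+$ with marginals $F$ and $G$, and let $d(F,\mathcal A)=\inf_{G\in\mathcal A}d_{\rm OT}(F,G)$. For $\alpha\ge 0$ consider the misspecification-averse newsvendor problem $$\max_{q\ge 0}\ \inf_{F\in\mathcal P}\big\{\mathbb E_F[\pi(q,\tilde u)]+\alpha\, d(F,\mathcal A)\big\}\qquad(\text{with } 0\cdot\infty=0).$$ Put $f(x)=\frac{1-2x}{2\sqrt{x(1-x)}}$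 for $0<x<1$, and read $p/0$ as $\infty$. Theorem (Optimal Solution). For every $\alpha\ge0$ the problem has exactly one optimal order quantity $q^\star_\alpha$, namely $$q^\star_\alpha=\begin{cases}\mu+\sigma f(1-\kappa)-\dfrac{p}{4\alpha} & \text{if } \kappa\ge\dfrac{\sigma^2}{\mu^2+\sigma^2} \text{ and } \alpha\ge\dfrac{p}{2(\mu-\sigma\sqrt{(1-\kappa)/\kappa})},\\[2mm] \big(\mu^2-\sigma^2+2\mu\sigma f(1-\kappa)\big)\cdot\dfrac{\alpha}{p} & \text{if } \kappa\ge\dfrac{\sigma^2}{\mu^2+\sigma^2} \text{ and } \alpha<\dfrac{p}{2(\mu-\sigma\sqrt{(1-\kappa)/\kappa})},\\[2mm] 0 & \text{if } \kappa<\dfrac{\sigma^2}{\mu^2+\sigma^2}.\end{cases}$$ Moreover $q^\star_\alpha$ is (weakly) increasing in $\alpha\in[0,\infty)$. -/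

import Mathlib

open MeasureTheory
open scoped NNReal ENNReal

noncomputable section

namespace Newsvendor

/-- Profit of ordering `q` at unit price `p` and unit cost `c` when the demand is `v`. -/
def profit (p c q v : ℝ) : ℝ := p * min q v - c * q

/-- The profit margin `κ = (p - c) / p`. -/
def margin (p c : ℝ) : ℝ := (p - c) / p

/-- The function `f(x) = (1 - 2x) / (2 √(x(1-x)))`, used for `0 < x < 1`. -/
def scarfF (x : ℝ) : ℝ := (1 - 2 * x) / (2 * √(x * (1 - x)))

/-- The joint laws on `ℝ₊ × ℝ₊` with marginals `F` and `G`. -/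
def couplings (F G : ProbabilityMeasure ℝ≥0) : Set (ProbabilityMeasure (ℝ≥0 × ℝ≥0)) :=
  {Γ | (Γ : Measure (ℝ≥0 × ℝ≥0)).map Prod.fst = (F : Measure ℝ≥0) ∧
       (Γ : Measure (ℝ≥0 × ℝ≥0)).map Prod.snd = (G : Measure ℝ≥0)}

/-- The optimal-transport cost between `F` and `G` for the cost `|u - v|²`, with value in
`[0, ∞]`. -/
def otCost (F G : ProbabilityMeasure ℝ≥0) : ℝ≥0∞ :=
  ⨅ Γ ∈ couplings F G,
    ∫⁻ x : ℝ≥0 × ℝ≥0, ENNReal.ofReal (|(x.1 : ℝ) - (x.2 : ℝ)| ^ 2)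
      ∂(Γ : Measure (ℝ≥0 × ℝ≥0))

/-- The mean-variance ambiguity set: the laws on `ℝ₊` with mean `μ` and second moment
`μ² + σ²` (the second moment being finite). -/
def ambiguitySet (μ σ : ℝ) : Set (ProbabilityMeasure ℝ≥0) :=
  {G | Integrable (fun v : ℝ≥0 => (v : ℝ) ^ 2) (G : Measure ℝ≥0) ∧
       ∫ v : ℝ≥0, (v : ℝ) ∂(G : Measure ℝ≥0) = μ ∧
       ∫ v : ℝ≥0, (v : ℝ) ^ 2 ∂(G : Measure ℝ≥0) = μ ^ 2 + σ ^ 2}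

/-- The transport cost from the law `F` to a set `A` of laws. -/
def distToSet (F : ProbabilityMeasure ℝ≥0) (A : Set (ProbabilityMeasure ℝ≥0)) : ℝ≥0∞ :=
  ⨅ G ∈ A, otCost F G

/-- The decision criterion of the misspecification-averse newsvendor at the order quantity `q`:
the infimum over all laws `F` on `ℝ₊` of `E_F[π(q,u)] + α d(F, A)`. For `q ≥ 0` the profit is a
bounded function of `u`, so that the expectation is a genuine one. -/
def criterion (p c μ σ α q : ℝ) : EReal :=
  ⨅ F : ProbabilityMeasure ℝ≥0,
    ((∫ u : ℝ≥0, profit p c q (u : ℝ) ∂(F : Measure ℝ≥0) : ℝ) : EReal) +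
      ((ENNReal.ofReal α * distToSet F (ambiguitySet μ σ) : ℝ≥0∞) : EReal)

/-- `q` is an optimal order quantity: it maximizes the criterion over `[0, ∞)`. -/
def IsOptimalOrder (p c μ σ α q : ℝ) : Prop :=
  0 ≤ q ∧ ∀ q' : ℝ, 0 ≤ q' → criterion p c μ σ α q' ≤ criterion p c μ σ α q

/-- The threshold `p / (2 (μ - σ √((1-κ)/κ)))` in `[0, ∞]`, for `μ ≥ σ √((1-κ)/κ)`;
division by zero gives `∞`. -/
def threshold (p c μ σ : ℝ) : ℝ≥0∞ :=
  ENNReal.ofReal p /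
    ENNReal.ofReal (2 * (μ - σ * √((1 - margin p c) / margin p c)))

/-- The closed-form order quantity. -/
def closedForm (p c μ σ α : ℝ) : ℝ :=
  if σ ^ 2 / (μ ^ 2 + σ ^ 2) ≤ margin p c then
    if threshold p c μ σ ≤ ENNReal.ofReal α then
      μ + σ * scarfF (1 - margin p c) - p / (4 * α)
    else
      (μ ^ 2 - σ ^ 2 + 2 * μ * σ * scarfF (1 - margin p c)) * (α / p)
  else 0

end Newsvendor

end

namespace Newsvendor

/-! Nature picks a reference law of mean `μ` and variance `σ²`, then moves each demand `v` to some
`u` at cost `α (u - v)²`. For `α > 0` the best move leaves revenue plus cost `min (p q) (huber v)`,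
where `huber` is convex in `v`.

Put `x = √((1-κ)/κ)`, `v₁ = μ - σ x`, `v₂ = μ + σ / x`, and suppose `v₁ ≥ 0`. The law with mass `κ`
at `v₁` and `1 - κ` at `v₂` is admissible. Since `(1 - κ) p = c`, it bounds the criterion by `κ *
huber v₁` whatever `q` is (`criterion_le_huber`). At `q = orderLevel` the bound is attained: for `σ
> 0` a concave parabola with apex `(v₂, p q)`, touching `huber` at `v₁`, lies below `min (p q)
(huber v)`, and its mean depends only on the two moments (`huber_le_criterion_orderLevel`, through
`le_criterion`). Perturbing `x` in the two-point family gives a first-order condition that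
determines `q` (`eq_orderLevel_of_huber_le_criterion`).

If `v₁ < 0`, a two-point law with an atom at `0` makes every `q > 0` worse than `0`. Monotonicity
holds because `slope` and `huber` increase with `α`. -/

/-! ### Two-point laws and upper bounds on the criterion -/

/-- The law with mass `w` at `a` and mass `1 - w` at `b`. -/
noncomputable def twoPoint {X : Type*} [MeasurableSpace X] (w : ℝ) (a b : X) : Measure X :=
  ENNReal.ofReal w • Measure.dirac a + ENNReal.ofReal (1 - w) • Measure.dirac b

lemma isProbabilityMeasure_twoPoint {X : Type*} [MeasurableSpace X] {w : ℝ} (h0 : 0 ≤ w)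
    (h1 : w ≤ 1) (a b : X) : IsProbabilityMeasure (twoPoint w a b) := by
  constructor
  simp only [twoPoint, Measure.add_apply, Measure.smul_apply, measure_univ, smul_eq_mul, mul_one]
  rw [← ENNReal.ofReal_add h0 (by linarith)]
  simp

lemma map_twoPoint {X Y : Type*} [MeasurableSpace X] [MeasurableSpace Y] {g : X → Y}
    (hg : Measurable g) (w : ℝ) (a b : X) :
    (twoPoint w a b).map g = twoPoint w (g a) (g b) := by
  simp [twoPoint, Measure.map_add _ _ hg, Measure.map_smul, Measure.map_dirac' hg]

lemma integrable_twoPoint {X : Type*} [MeasurableSpace X] [MeasurableSingletonClass X]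
    (w : ℝ) (a b : X) (g : X → ℝ) : Integrable g (twoPoint w a b) := by
  refine Integrable.add_measure ?_ ?_ <;>
  exact (integrable_dirac (by simp)).smul_measure ENNReal.ofReal_ne_top

lemma integral_twoPoint {X : Type*} [MeasurableSpace X] [MeasurableSingletonClass X]
    {w : ℝ} (h0 : 0 ≤ w) (h1 : w ≤ 1) (a b : X) (g : X → ℝ) :
    ∫ x, g x ∂(twoPoint w a b) = w * g a + (1 - w) * g b := by
  unfold twoPoint
  rw [integral_add_measure, integral_smul_measure, integral_smul_measure, integral_dirac,
    integral_dirac, ENNReal.toReal_ofReal h0, ENNReal.toReal_ofReal (by linarith)]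
  · simp
  all_goals exact (integrable_dirac (by simp)).smul_measure ENNReal.ofReal_ne_top

lemma lintegral_twoPoint {X : Type*} [MeasurableSpace X] [MeasurableSingletonClass X]
    (w : ℝ) (a b : X) (g : X → ℝ≥0∞) :
    ∫⁻ x, g x ∂(twoPoint w a b) = ENNReal.ofReal w * g a + ENNReal.ofReal (1 - w) * g b := by
  simp [twoPoint]

lemma criterion_le {p c μ σ α q : ℝ} {F G : ProbabilityMeasure ℝ≥0}
    {Γ : ProbabilityMeasure (ℝ≥0 × ℝ≥0)} (hG : G ∈ ambiguitySet μ σ) (hΓ : Γ ∈ couplings F G) :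
    criterion p c μ σ α q ≤
      ((∫ u : ℝ≥0, profit p c q (u : ℝ) ∂(F : Measure ℝ≥0) : ℝ) : EReal) +
      ((ENNReal.ofReal α * ∫⁻ x : ℝ≥0 × ℝ≥0, ENNReal.ofReal (|(x.1 : ℝ) - (x.2 : ℝ)| ^ 2)
        ∂(Γ : Measure (ℝ≥0 × ℝ≥0)) : ℝ≥0∞) : EReal) := by
  refine (iInf_le _ F).trans (add_le_add_right ?_ _)
  refine EReal.coe_ennreal_le_coe_ennreal_iff.2 (mul_le_mul_right ?_ _)
  exact (iInf₂_le G hG).trans (iInf₂_le Γ hΓ)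

/-- Upper bound on the criterion by a two-point reference law whose lower atom `v₁` is moved
to `u₁`. -/
lemma criterion_le_twoPoint {p c μ σ α q w u₁ v₁ v₂ : ℝ} (hp : 0 ≤ p) (hα : 0 ≤ α)
    (h0 : 0 ≤ w) (h1 : w ≤ 1) (hu₁ : 0 ≤ u₁) (hv₁ : 0 ≤ v₁) (hv₂ : 0 ≤ v₂)
    (hm : w * v₁ + (1 - w) * v₂ = μ) (hm2 : w * v₁ ^ 2 + (1 - w) * v₂ ^ 2 = μ ^ 2 + σ ^ 2) :
    criterion p c μ σ α q ≤
      ((w * (p * u₁ + α * (u₁ - v₁) ^ 2) + (1 - w) * (p * q) - c * q : ℝ) : EReal) := by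
  lift u₁ to ℝ≥0 using hu₁
  lift v₁ to ℝ≥0 using hv₁
  lift v₂ to ℝ≥0 using hv₂
  let G : ProbabilityMeasure ℝ≥0 := ⟨twoPoint w v₁ v₂, isProbabilityMeasure_twoPoint h0 h1 _ _⟩
  let F : ProbabilityMeasure ℝ≥0 := ⟨twoPoint w u₁ v₂, isProbabilityMeasure_twoPoint h0 h1 _ _⟩
  let Γ : ProbabilityMeasure (ℝ≥0 × ℝ≥0) :=
    ⟨twoPoint w (u₁, v₁) (v₂, v₂), isProbabilityMeasure_twoPoint h0 h1 _ _⟩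
  have hG : G ∈ ambiguitySet μ σ := by
    refine ⟨integrable_twoPoint _ _ _ _, ?_, ?_⟩
    · exact (integral_twoPoint h0 h1 _ _ _).trans hm
    · exact (integral_twoPoint h0 h1 _ _ _).trans hm2
  have hΓ : Γ ∈ couplings F G :=
    ⟨map_twoPoint measurable_fst _ _ _, map_twoPoint measurable_snd _ _ _⟩
  refine (criterion_le hG hΓ).trans ?_
  have hI : ∫ u : ℝ≥0, profit p c q (u : ℝ) ∂(F : Measure ℝ≥0) =
      w * profit p c q u₁ + (1 - w) * profit p c q v₂ := integral_twoPoint h0 h1 _ _ _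
  have hC : ENNReal.ofReal α * ∫⁻ x : ℝ≥0 × ℝ≥0, ENNReal.ofReal (|(x.1 : ℝ) - (x.2 : ℝ)| ^ 2)
        ∂(Γ : Measure (ℝ≥0 × ℝ≥0)) = ENNReal.ofReal (α * (w * ((u₁ : ℝ) - v₁) ^ 2)) := by
    rw [show (Γ : Measure (ℝ≥0 × ℝ≥0)) = twoPoint w (u₁, v₁) (v₂, v₂) from rfl,
      lintegral_twoPoint, ENNReal.ofReal_mul hα, ENNReal.ofReal_mul h0]
    simp
  rw [hI, hC, EReal.coe_ennreal_ofReal, max_eq_left (by positivity), ← EReal.coe_add]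
  refine EReal.coe_le_coe_iff.2 ?_
  have e1 : p * min q u₁ ≤ p * u₁ := mul_le_mul_of_nonneg_left (min_le_right _ _) hp
  have e2 : p * min q v₂ ≤ p * q := mul_le_mul_of_nonneg_left (min_le_left _ _) hp
  unfold profit
  nlinarith [mul_le_mul_of_nonneg_left e1 h0, mul_le_mul_of_nonneg_left e2 (sub_nonneg.2 h1)]

lemma criterion_alpha_zero_le (p c μ σ : ℝ) {q : ℝ} (hq : 0 ≤ q) :
    criterion p c μ σ 0 q ≤ ((-(c * q) : ℝ) : EReal) := by
  refine (iInf_le _ (⟨Measure.dirac 0, inferInstance⟩ : ProbabilityMeasure ℝ≥0)).trans ?_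
  simp [profit, min_eq_right hq]

lemma criterion_zero_nonneg (p c μ σ α : ℝ) : 0 ≤ criterion p c μ σ α 0 := by
  refine le_iInf fun F => ?_
  refine add_nonneg ?_ (EReal.coe_ennreal_nonneg _)
  simp [profit]

/-! ### Weak duality: quadratic minorants -/

lemma integrable_profit {p c q : ℝ} (hq : 0 ≤ q) (F : Measure ℝ≥0) [IsFiniteMeasure F] :
    Integrable (fun u : ℝ≥0 => profit p c q (u : ℝ)) F := by
  have : Integrable (fun u : ℝ≥0 => min q (u : ℝ)) F := by
    refine Integrable.of_bound (C := q) (by fun_prop) (.of_forall fun u => ?_)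
    rw [Real.norm_of_nonneg (le_min hq u.coe_nonneg)]
    exact min_le_left _ _
  exact (this.const_mul p).sub (integrable_const _)

lemma integrable_coe_of_sq {G : Measure ℝ≥0} [IsFiniteMeasure G]
    (hG2 : Integrable (fun v : ℝ≥0 => (v : ℝ) ^ 2) G) : Integrable (fun v : ℝ≥0 => (v : ℝ)) G := by
  refine ((integrable_const (1 : ℝ)).add hG2).mono' (by fun_prop) (.of_forall fun v => ?_)
  rw [Real.norm_of_nonneg v.coe_nonneg]
  simp only [Pi.add_apply]
  nlinarith [sq_nonneg ((v : ℝ) - 1), v.coe_nonneg]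

/-- Lower bound on the criterion by a quadratic function of the reference demand. -/
lemma le_criterion {p c μ σ α q a₀ a₁ a₂ : ℝ} (hα : 0 < α) (hq : 0 ≤ q)
    (h : ∀ G ∈ ambiguitySet μ σ, ∀ᵐ v : ℝ≥0 ∂(G : Measure ℝ≥0), ∀ u : ℝ, 0 ≤ u →
      a₀ + a₁ * v + a₂ * (v : ℝ) ^ 2 ≤ p * min q u + α * (u - v) ^ 2) :
    ((a₀ + a₁ * μ + a₂ * (μ ^ 2 + σ ^ 2) - c * q : ℝ) : EReal) ≤ criterion p c μ σ α q := by
  refine le_iInf fun F => ?_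
  set B := a₀ + a₁ * μ + a₂ * (μ ^ 2 + σ ^ 2) - c * q
  set I := ∫ u : ℝ≥0, profit p c q (u : ℝ) ∂(F : Measure ℝ≥0) with hI
  -- In `ℝ≥0∞` the bound can be checked separately for each reference law and each coupling.
  suffices hd : ENNReal.ofReal (B - I) ≤ ENNReal.ofReal α * distToSet F (ambiguitySet μ σ) by
    calc (B : EReal) = (I : EReal) + ((B - I : ℝ) : EReal) := by
          rw [← EReal.coe_add]; congr 1; ring
      _ ≤ (I : EReal) + (ENNReal.ofReal (B - I) : EReal) := by
          refine add_le_add_right ?_ _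
          rw [EReal.coe_ennreal_ofReal]
          exact EReal.coe_le_coe_iff.2 (le_max_left _ _)
      _ ≤ _ := add_le_add_right (EReal.coe_ennreal_le_coe_ennreal_iff.2 hd) _
  have hα0 : ENNReal.ofReal α ≠ 0 := by simpa using hα
  rw [mul_comm, ← ENNReal.div_le_iff hα0 ENNReal.ofReal_ne_top]
  refine le_iInf₂ fun G hG => le_iInf₂ fun Γ hΓ => ?_
  rw [ENNReal.div_le_iff hα0 ENNReal.ofReal_ne_top, mul_comm]
  obtain ⟨hΓF, hΓG⟩ := hΓ
  obtain ⟨hG2, hGm, hGs⟩ := id hG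
  set L := ∫⁻ x : ℝ≥0 × ℝ≥0, ENNReal.ofReal (|(x.1 : ℝ) - (x.2 : ℝ)| ^ 2)
      ∂(Γ : Measure (ℝ≥0 × ℝ≥0)) with hL
  rcases eq_or_ne L ⊤ with hLt | hLt
  · simp [hLt, ENNReal.mul_top hα0]
  have hmeas : AEStronglyMeasurable (fun x : ℝ≥0 × ℝ≥0 => |(x.1 : ℝ) - (x.2 : ℝ)| ^ 2)
      (Γ : Measure (ℝ≥0 × ℝ≥0)) := by fun_prop
  have hCint : Integrable (fun x : ℝ≥0 × ℝ≥0 => |(x.1 : ℝ) - (x.2 : ℝ)| ^ 2)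
      (Γ : Measure (ℝ≥0 × ℝ≥0)) :=
    (lintegral_ofReal_ne_top_iff_integrable hmeas (.of_forall fun x => by positivity)).1 hLt
  have hLeq : L = ENNReal.ofReal (∫ x : ℝ≥0 × ℝ≥0, |(x.1 : ℝ) - (x.2 : ℝ)| ^ 2
      ∂(Γ : Measure (ℝ≥0 × ℝ≥0))) :=
    (ofReal_integral_eq_lintegral_ofReal hCint (.of_forall fun x => by positivity)).symm
  rw [hLeq, ← ENNReal.ofReal_mul hα.le]
  refine ENNReal.ofReal_le_ofReal ?_
  have hG1 : Integrable (fun v : ℝ≥0 => (v : ℝ)) (G : Measure ℝ≥0) :=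
    integrable_coe_of_sq hG2
  have hG01 : Integrable (fun v : ℝ≥0 => a₀ + a₁ * (v : ℝ)) (G : Measure ℝ≥0) :=
    (integrable_const _).add (hG1.const_mul _)
  have hg : Integrable (fun v : ℝ≥0 => a₀ + a₁ * (v : ℝ) + a₂ * (v : ℝ) ^ 2)
      (G : Measure ℝ≥0) :=
    hG01.add (hG2.const_mul _)
  have hgI : ∫ v : ℝ≥0, (a₀ + a₁ * (v : ℝ) + a₂ * (v : ℝ) ^ 2) ∂(G : Measure ℝ≥0) =
      a₀ + a₁ * μ + a₂ * (μ ^ 2 + σ ^ 2) := by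
    rw [integral_add hG01 (hG2.const_mul _),
      integral_add (integrable_const _) (hG1.const_mul _), integral_const_mul,
      integral_const_mul, hGm, hGs]
    simp
  have hpI := integrable_profit (p := p) (c := c) hq (F : Measure ℝ≥0)
  rw [← hΓF] at hpI hI
  rw [integral_map measurable_fst.aemeasurable hpI.1] at hI
  rw [← hΓG] at hg hgI
  rw [integral_map measurable_snd.aemeasurable hg.1] at hgI
  have hpI' : Integrable (fun x : ℝ≥0 × ℝ≥0 => profit p c q (x.1 : ℝ))
      (Γ : Measure (ℝ≥0 × ℝ≥0)) := hpI.comp_measurable measurable_fst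
  have hpc : Integrable (fun x : ℝ≥0 × ℝ≥0 => profit p c q (x.1 : ℝ) + c * q)
      (Γ : Measure (ℝ≥0 × ℝ≥0)) := hpI'.add (integrable_const _)
  have hg' := hg.comp_measurable measurable_snd
  have hae := h G hG
  rw [← hΓG] at hae
  have hae' := ae_of_ae_map measurable_snd.aemeasurable hae
  have key : ∫ x : ℝ≥0 × ℝ≥0, (a₀ + a₁ * (x.2 : ℝ) + a₂ * (x.2 : ℝ) ^ 2)
        ∂(Γ : Measure (ℝ≥0 × ℝ≥0)) ≤
      ∫ x : ℝ≥0 × ℝ≥0, (profit p c q (x.1 : ℝ) + c * q + α * |(x.1 : ℝ) - (x.2 : ℝ)| ^ 2)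
        ∂(Γ : Measure (ℝ≥0 × ℝ≥0)) := by
    refine integral_mono_ae hg' (hpc.add (hCint.const_mul α)) ?_
    filter_upwards [hae'] with x hx
    have := hx x.1 x.1.2
    simp only [profit, sq_abs]
    linarith
  rw [integral_add hpc (hCint.const_mul α),
    integral_add hpI' (integrable_const _), integral_const_mul α, hgI] at key
  simp only [integral_const, probReal_univ, smul_eq_mul, one_mul] at key
  simp only [B, hI]
  linarith

/-! ### The inf-convolution and the order level -/

/-- The derivative at `v` of the inf-convolution `v ↦ inf_u (p u + α (u - v)²)` over `u ≥ 0`. -/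
noncomputable def slope (p α v : ℝ) : ℝ := min p (2 * α * v)

/-- The value at `v` of the inf-convolution `v ↦ inf_u (p u + α (u - v)²)` over `u ≥ 0`. -/
noncomputable def huber (p α v : ℝ) : ℝ := slope p α v * v - slope p α v ^ 2 / (4 * α)

/-- The order quantity for which the worst-case reference law has atoms `v₁` and `v₂`. -/
noncomputable def orderLevel (p α v₁ v₂ : ℝ) : ℝ :=
  (huber p α v₁ + slope p α v₁ * (v₂ - v₁) / 2) / p

lemma slope_nonneg {p α v : ℝ} (hp : 0 ≤ p) (hα : 0 ≤ α) (hv : 0 ≤ v) : 0 ≤ slope p α v :=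
  le_min hp (by positivity)

lemma huber_nonneg {p α v : ℝ} (hp : 0 ≤ p) (hα : 0 < α) (hv : 0 ≤ v) : 0 ≤ huber p α v := by
  have h0 := slope_nonneg hp hα.le hv
  have h1 : slope p α v ≤ 2 * α * v := min_le_right _ _
  have : slope p α v ^ 2 / (4 * α) ≤ slope p α v * v := by
    rw [div_le_iff₀ (by positivity)]
    nlinarith [mul_nonneg h0 (mul_nonneg hα.le hv), mul_le_mul_of_nonneg_left h1 h0]
  unfold huber
  linarith

lemma orderLevel_nonneg {p α v₁ v₂ : ℝ} (hp : 0 ≤ p) (hα : 0 < α) (hv : 0 ≤ v₁)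
    (hv₂ : v₁ ≤ v₂) : 0 ≤ orderLevel p α v₁ v₂ :=
  div_nonneg (add_nonneg (huber_nonneg hp hα hv)
    (div_nonneg (mul_nonneg (slope_nonneg hp hα.le hv) (by linarith)) (by norm_num))) hp

/-- The slope vanishes and `0 / 0 = 0`, so the same formula covers `α = 0`. -/
lemma orderLevel_alpha_zero {p v₁ v₂ : ℝ} (hp : 0 ≤ p) : orderLevel p 0 v₁ v₂ = 0 := by
  simp [orderLevel, huber, slope, hp]

lemma huber_mono {p α₁ α₂ v : ℝ} (hα : 0 < α₁) (h : α₁ ≤ α₂) (hp : 0 ≤ p)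
    (hv : 0 ≤ v) : slope p α₁ v ≤ slope p α₂ v ∧ huber p α₁ v ≤ huber p α₂ v := by
  have hα₂ := hα.trans_le h
  have hs : slope p α₁ v ≤ slope p α₂ v := min_le_min_left _ (by gcongr)
  have h2 : slope p α₂ v ≤ 2 * α₂ * v := min_le_right _ _
  have h0 := slope_nonneg hp hα.le hv
  refine ⟨hs, ?_⟩
  unfold huber
  set s := slope p α₁ v
  set t := slope p α₂ v
  have e1 : s ^ 2 / (4 * α₂) ≤ s ^ 2 / (4 * α₁) := by gcongr
  -- The map `r ↦ r v - r² / (4 α₂)` increases up to `2 α₂ v`, and `s ≤ t ≤ 2 α₂ v`.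
  have e2 : s * v - s ^ 2 / (4 * α₂) ≤ t * v - t ^ 2 / (4 * α₂) := by
    have : t * v - t ^ 2 / (4 * α₂) - (s * v - s ^ 2 / (4 * α₂)) =
        (t - s) * (4 * α₂ * v - t - s) / (4 * α₂) := by field_simp; ring
    have : 0 ≤ (t - s) * (4 * α₂ * v - t - s) / (4 * α₂) := by
      refine div_nonneg (mul_nonneg ?_ ?_) ?_ <;> linarith
    linarith
  linarith

lemma orderLevel_mono {p α₁ α₂ v₁ v₂ : ℝ} (hα : 0 ≤ α₁) (h : α₁ ≤ α₂) (hp : 0 ≤ p)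
    (hv : 0 ≤ v₁) (hv₂ : v₁ ≤ v₂) : orderLevel p α₁ v₁ v₂ ≤ orderLevel p α₂ v₁ v₂ := by
  rcases hα.eq_or_lt with rfl | hα
  · rw [orderLevel_alpha_zero hp]
    rcases h.eq_or_lt with rfl | h
    · rw [orderLevel_alpha_zero hp]
    · exact orderLevel_nonneg hp h hv hv₂
  · obtain ⟨h1, h2⟩ := huber_mono hα h hp hv
    have : 0 ≤ v₂ - v₁ := by linarith
    unfold orderLevel
    gcongr

/-- The fraction of `v` to which the worst-case law moves the atom `v`. -/
lemma exists_fraction {p : ℝ} (hp : 0 < p) (α v : ℝ) :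
    ∃ ρ : ℝ, 0 ≤ ρ ∧ ρ ≤ 1 ∧ (1 - ρ) * (2 * α * v) = slope p α v ∧ p * ρ = slope p α v * ρ := by
  rcases lt_or_ge p (2 * α * v) with h | h
  · have h0 : 0 < 2 * α * v := hp.trans h
    refine ⟨1 - p / (2 * α * v), ?_, ?_, ?_, ?_⟩
    · rw [sub_nonneg, div_le_one h0]; exact h.le
    · have : 0 ≤ p / (2 * α * v) := by positivity
      linarith
    · rw [slope, min_eq_left h.le, sub_sub_cancel, div_mul_cancel₀ _ h0.ne']
    · rw [slope, min_eq_left h.le]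
  · exact ⟨0, le_rfl, zero_le_one, by simp [slope, h], by simp⟩

/-- The hypotheses are the first-order and complementary slackness conditions for the minimizer `u =
ρ v`. -/
lemma huber_eq {p α v ρ : ℝ} (hα : 0 < α)
    (h1 : (1 - ρ) * (2 * α * v) = slope p α v) (h2 : p * ρ = slope p α v * ρ) :
    p * (ρ * v) + α * (ρ * v - v) ^ 2 = huber p α v := by
  have e : slope p α v ^ 2 / (4 * α) = slope p α v * (1 - ρ) * v / 2 := by
    rw [div_eq_iff (by positivity)]
    linear_combination (-slope p α v) * h1
  rw [huber, e]
  linear_combination v * h2 + (1 - ρ) * v / 2 * h1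

/-! ### The two-point family: upper bound and uniqueness -/

/-- Upper bound on the criterion by the two-point law with mean `μ` and variance `σ²` whose
atoms are `μ - σ y` and `μ + σ / y`. -/
lemma criterion_le_scarf {p c μ σ α q y ρ : ℝ} (hp : 0 ≤ p) (hμ : 0 < μ) (hσ : 0 ≤ σ)
    (hα : 0 ≤ α) (hy : 0 < y) (hv : 0 ≤ μ - σ * y) (hρ : 0 ≤ ρ) :
    criterion p c μ σ α q ≤
      ((1 / (1 + y ^ 2) * (p * (ρ * (μ - σ * y)) + α * (ρ * (μ - σ * y) - (μ - σ * y)) ^ 2) +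
        (1 - 1 / (1 + y ^ 2)) * (p * q) - c * q : ℝ) : EReal) := by
  refine criterion_le_twoPoint (v₂ := μ + σ / y) hp hα (by positivity) ?_ (by positivity) hv
    (by positivity) ?_ ?_
  · rw [div_le_one (by positivity)]
    nlinarith [sq_nonneg y]
  · field_simp; ring
  · field_simp; ring

lemma nonpos_of_forall_le_mul {A B δ : ℝ} (hδ : 0 < δ) (h : ∀ t, 0 < t → t < δ → A ≤ B * t) :
    A ≤ 0 := by
  by_contra! hA
  have hB : 0 < |B| + 1 := by positivity
  have ht : 0 < min (δ / 2) (A / (2 * (|B| + 1))) := lt_min (by positivity) (by positivity)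
  have h1 := h _ ht ((min_le_left _ _).trans_lt (by linarith))
  set t := min (δ / 2) (A / (2 * (|B| + 1)))
  have h2 : t * (2 * (|B| + 1)) ≤ A := (le_div_iff₀ (by positivity)).1 (min_le_right _ _)
  nlinarith [le_abs_self B]

lemma neg_le_mul_of_nonneg {A B t : ℝ} (ht : 0 < t) (h : 0 ≤ A * t + B * t ^ 2) : -A ≤ B * t := by
  have : 0 ≤ t * (A + B * t) := by linarith [h, sq t]
  linarith [nonneg_of_mul_nonneg_right this ht]

section

variable {p c μ σ α x : ℝ}

lemma criterion_le_huber (hc : 0 < c) (hcp : c < p) (hμ : 0 < μ) (hσ : 0 ≤ σ) (hα : 0 < α)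
    (hx : 0 < x) (hxc : c * (1 + x ^ 2) = p * x ^ 2) (hv : 0 ≤ μ - σ * x) (q : ℝ) :
    criterion p c μ σ α q ≤ ((1 / (1 + x ^ 2) * huber p α (μ - σ * x) : ℝ) : EReal) := by
  have hp := hc.trans hcp
  obtain ⟨ρ, h0, -, h1, h2⟩ := exists_fraction hp α _
  refine (criterion_le_scarf hp.le hμ hσ hα.le hx hv h0).trans (EReal.coe_le_coe_iff.2 ?_)
  rw [huber_eq hα h1 h2]
  refine le_of_eq ?_
  field_simp
  linear_combination (-q) * hxc

lemma eq_orderLevel_of_huber_le_criterion (hc : 0 < c) (hcp : c < p) (hμ : 0 < μ) (hσ : 0 ≤ σ)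
    (hα : 0 < α) (hx : 0 < x) (hxc : c * (1 + x ^ 2) = p * x ^ 2) (hv : 0 ≤ μ - σ * x) {q : ℝ}
    (hq : 0 ≤ q)
    (h : ((1 / (1 + x ^ 2) * huber p α (μ - σ * x) : ℝ) : EReal) ≤ criterion p c μ σ α q) :
    q = orderLevel p α (μ - σ * x) (μ + σ / x) := by
  have hp := hc.trans hcp
  obtain ⟨ρ, h0, -, h1, h2⟩ := exists_fraction hp α _
  have hH := huber_eq hα h1 h2
  set v := μ - σ * x with hvdef
  set s := slope p α v with hs
  set H := huber p α v with hHdef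
  have hx2 : (0 : ℝ) < 1 + x ^ 2 := by positivity
  have hκ : p - c = 1 / (1 + x ^ 2) * p := by
    field_simp
    linear_combination -hxc
  set κ := 1 / (1 + x ^ 2) with hκdef
  set A := 2 * x * κ * (p * q - H) - σ * s with hA
  set B := α * (1 - ρ) ^ 2 * σ ^ 2 + κ * (p * q - H) with hB
  -- With `ρ` frozen, clearing the denominator `1 + (x + e)²` leaves a quadratic in `e`; its
  -- constant term vanishes because the bound is tight at `e = 0`.
  have hD : ∀ e, 0 < x + e → 0 ≤ v - σ * e → 0 ≤ A * e + B * e ^ 2 := by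
    intro e he hve
    have hve' : μ - σ * (x + e) = v - σ * e := by rw [hvdef]; ring
    have := EReal.coe_le_coe_iff.1
      (h.trans (criterion_le_scarf hp.le hμ hσ hα.le he (hve'.symm ▸ hve) h0))
    rw [hve'] at this
    have hy2 : (0 : ℝ) < 1 + (x + e) ^ 2 := by positivity
    have h3 := mul_le_mul_of_nonneg_left this hy2.le
    have h4 : (1 + (x + e) ^ 2) * (1 / (1 + (x + e) ^ 2) *
        (p * (ρ * (v - σ * e)) + α * (ρ * (v - σ * e) - (v - σ * e)) ^ 2) +
        (1 - 1 / (1 + (x + e) ^ 2)) * (p * q) - c * q) =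
        p * (ρ * (v - σ * e)) + α * (ρ * (v - σ * e) - (v - σ * e)) ^ 2
          + (x + e) ^ 2 * (p * q) - (1 + (x + e) ^ 2) * (c * q) := by
      field_simp
      ring
    rw [h4] at h3
    have h5 : κ * (1 + x ^ 2) = 1 := by rw [hκdef]; field_simp
    have h6 : A * e + B * e ^ 2 = p * (ρ * (v - σ * e)) + α * (ρ * (v - σ * e) - (v - σ * e)) ^ 2
          + (x + e) ^ 2 * (p * q) - (1 + (x + e) ^ 2) * (c * q) - (1 + (x + e) ^ 2) * (κ * H) := by
      have hc' : c = p - κ * p := by linarith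
      rw [hc', hA, hB]
      linear_combination (H - p * q) * h5 - hH + σ * e * (1 - ρ) * h1 + σ * e * h2
    linarith
  have hval : p * orderLevel p α v (μ + σ / x) = H + σ * s * (1 + x ^ 2) / (2 * x) := by
    rw [orderLevel, mul_div_cancel₀ _ hp.ne', hvdef]
    field_simp
    ring
  have hAq : A = 2 * x * κ * (p * q - p * orderLevel p α v (μ + σ / x)) := by
    rw [hval, hA, hκdef]
    field_simp
    ring
  have hκ0 : 0 < 2 * x * κ := by positivity
  have hle : A ≤ 0 := by
    refine nonpos_of_forall_le_mul (B := B) hx fun t ht htx => ?_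
    have hst : 0 ≤ v - σ * -t := by linarith [mul_nonneg hσ ht.le]
    have := neg_le_mul_of_nonneg (A := -A) (B := B) ht (by linarith [hD (-t) (by linarith) hst])
    linarith
  have hq_le : q ≤ orderLevel p α v (μ + σ / x) := by
    rw [hAq] at hle
    have := nonpos_of_mul_nonpos_right hle hκ0
    exact le_of_mul_le_mul_left (by linarith) hp
  -- If the lower atom is `0`, it cannot be lowered further, so only `A ≤ 0` is used; but then the
  -- order level is `0` and `q ≥ 0` closes the gap.
  rcases hv.eq_or_lt with hv0 | hv0
  · refine le_antisymm hq_le (le_trans (le_of_eq ?_) hq)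
    have hs0 : s = 0 := by rw [hs, slope, ← hv0]; simp [hp.le]
    have : H = 0 := by rw [hHdef, huber, ← hs, hs0]; simp
    rw [orderLevel, ← hHdef, ← hs, this, hs0]
    simp
  · refine le_antisymm hq_le ?_
    have hge : -A ≤ 0 := by
      -- This range keeps the lower atom nonnegative; the `+ 1` covers `σ = 0`.
      refine nonpos_of_forall_le_mul (B := B) (δ := v / (σ + 1)) (by positivity)
        fun t ht htx => ?_
      rw [lt_div_iff₀ (by positivity)] at htx
      have hst : 0 ≤ v - σ * t := by linarith
      exact neg_le_mul_of_nonneg ht (hD t (by linarith) hst)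
    rw [hAq] at hge
    have : 0 ≤ p * q - p * orderLevel p α v (μ + σ / x) :=
      nonneg_of_mul_nonneg_right (by linarith) hκ0
    exact le_of_mul_le_mul_left (by linarith) hp

/-! ### Attainment at the order level -/

/-- Replace the price `p` by the smaller slope and complete the square in `u`. -/
lemma tangent_le {u : ℝ} (hα : 0 < α) (hu : 0 ≤ u) (v v₁ : ℝ) :
    slope p α v₁ * v - slope p α v₁ ^ 2 / (4 * α) ≤ p * u + α * (u - v) ^ 2 := by
  have hsp : slope p α v₁ ≤ p := min_le_left _ _
  set s := slope p α v₁
  have h1 : s * u + α * (u - v) ^ 2 - (s * v - s ^ 2 / (4 * α)) =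
      α * (u - v + s / (2 * α)) ^ 2 := by field_simp; ring
  have h2 : 0 ≤ α * (u - v + s / (2 * α)) ^ 2 := by positivity
  have h3 : s * u ≤ p * u := mul_le_mul_of_nonneg_right hsp hu
  linarith

/-- For `u ≥ q` the apex value `p q` suffices. For `u ≤ q` the parabola lies below its tangent at
`v₁`, which `tangent_le` handles; `hbs` matches the slopes there and `hq` the values. -/
lemma mul_min_add_ge {q u v v₁ v₂ : ℝ} (hα : 0 < α) (hu : 0 ≤ u)
    {b : ℝ} (hb : 0 ≤ b) (hbs : 2 * b * (v₂ - v₁) = slope p α v₁)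
    (hq : p * q = huber p α v₁ + slope p α v₁ * (v₂ - v₁) / 2) :
    p * q - b * (v - v₂) ^ 2 ≤ p * min q u + α * (u - v) ^ 2 := by
  rcases le_total q u with h | h
  · rw [min_eq_left h]
    linarith [mul_nonneg hb (sq_nonneg (v - v₂)), mul_nonneg hα.le (sq_nonneg (u - v))]
  · rw [min_eq_right h, hq, huber]
    have h1 := tangent_le (p := p) hα hu v v₁
    have h2 : slope p α v₁ * v - slope p α v₁ * v₁ - slope p α v₁ * (v₂ - v₁) / 2
        + b * (v - v₂) ^ 2 = b * (v - v₁) ^ 2 := by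
      rw [← hbs]; ring
    linarith [mul_nonneg hb (sq_nonneg (v - v₁))]

/-- For `σ = 0` the two atoms coincide and no parabola is available; a constant bound at the point
`μ` replaces it, which is why `le_criterion` asks only for an almost sure inequality. -/
lemma ae_eq_mean {G : ProbabilityMeasure ℝ≥0} (hG : G ∈ ambiguitySet μ 0) :
    ∀ᵐ v : ℝ≥0 ∂(G : Measure ℝ≥0), (v : ℝ) = μ := by
  obtain ⟨h2, hm, hs⟩ := hG
  have hG1 : Integrable (fun v : ℝ≥0 => (v : ℝ)) (G : Measure ℝ≥0) :=
    integrable_coe_of_sq h2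
  have h21 : Integrable (fun v : ℝ≥0 => (v : ℝ) ^ 2 - 2 * μ * (v : ℝ)) (G : Measure ℝ≥0) :=
    h2.sub (hG1.const_mul _)
  have e : (fun v : ℝ≥0 => ((v : ℝ) - μ) ^ 2) =
      fun v : ℝ≥0 => ((v : ℝ) ^ 2 - 2 * μ * (v : ℝ)) + μ ^ 2 := by
    funext v; ring
  have hint : Integrable (fun v : ℝ≥0 => ((v : ℝ) - μ) ^ 2) (G : Measure ℝ≥0) := by
    rw [e]; exact h21.add (integrable_const _)
  have h0 : ∫ v : ℝ≥0, ((v : ℝ) - μ) ^ 2 ∂(G : Measure ℝ≥0) = 0 := by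
    rw [e, integral_add h21 (integrable_const _), integral_sub h2 (hG1.const_mul _),
      integral_const_mul (2 * μ), hm, hs]
    simp
    ring
  filter_upwards [(integral_eq_zero_iff_of_nonneg (fun v => sq_nonneg _) hint).1 h0] with v hv
  simpa [sub_eq_zero] using hv

lemma huber_le_criterion_orderLevel (hc : 0 < c) (hcp : c < p) (hσ : 0 ≤ σ)
    (hα : 0 < α) (hx : 0 < x) (hxc : c * (1 + x ^ 2) = p * x ^ 2) (hv : 0 ≤ μ - σ * x) :
    ((1 / (1 + x ^ 2) * huber p α (μ - σ * x) : ℝ) : EReal) ≤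
      criterion p c μ σ α (orderLevel p α (μ - σ * x) (μ + σ / x)) := by
  have hp := hc.trans hcp
  have hd : (μ + σ / x) - (μ - σ * x) = σ * (1 + x ^ 2) / x := by field_simp; ring
  have hd0 : 0 ≤ σ * (1 + x ^ 2) / x := by positivity
  set q := orderLevel p α (μ - σ * x) (μ + σ / x) with hqdef
  have hq0 : 0 ≤ q := orderLevel_nonneg hp.le hα hv (by linarith)
  have hq : p * q = huber p α (μ - σ * x) +
      slope p α (μ - σ * x) * ((μ + σ / x) - (μ - σ * x)) / 2 := by
    rw [hqdef, orderLevel, mul_div_cancel₀ _ hp.ne']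
  have hs0 := slope_nonneg hp.le hα.le hv
  have hcq : c * q = x ^ 2 / (1 + x ^ 2) * (p * q) := by
    field_simp
    linear_combination q * hxc
  rcases hσ.eq_or_lt with rfl | hσ
  · refine le_trans (EReal.coe_le_coe_iff.2 (le_of_eq ?_))
      (le_criterion (a₀ := p * q) (a₁ := 0) (a₂ := 0) hα hq0 fun G hG => ?_)
    · rw [hcq, hq]
      field_simp
      ring
    · filter_upwards [ae_eq_mean hG] with v hvμ u hu
      rw [hvμ]
      rcases le_total q u with h | h
      · rw [min_eq_left h]
        linarith [mul_nonneg hα.le (sq_nonneg (u - μ))]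
      · rw [min_eq_right h, hq, hd, huber]
        have := tangent_le (p := p) hα hu μ (μ - 0 * x)
        simp only [zero_mul, sub_zero, zero_div, mul_zero, add_zero] at this ⊢
        exact this
  · have hdpos : 0 < (μ + σ / x) - (μ - σ * x) := by rw [hd]; positivity
    set b := slope p α (μ - σ * x) / (2 * ((μ + σ / x) - (μ - σ * x))) with hb
    have hb0 : 0 ≤ b := by positivity
    have hbs : 2 * b * ((μ + σ / x) - (μ - σ * x)) = slope p α (μ - σ * x) := by
      rw [hb]
      generalize (μ + σ / x) - (μ - σ * x) = d at hdpos
      field_simp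
    refine le_trans (EReal.coe_le_coe_iff.2 (le_of_eq ?_))
      (le_criterion (a₀ := p * q - b * (μ + σ / x) ^ 2) (a₁ := 2 * b * (μ + σ / x)) (a₂ := -b)
        hα hq0 fun G hG => .of_forall fun v u hu => ?_)
    · rw [hcq, hq, ← hbs]
      field_simp
      ring
    · have := mul_min_add_ge (v := v) hα hu hb0 hbs hq
      refine le_trans (le_of_eq ?_) this
      ring

end

/-! ### Characterization of the optimal orders -/

section

variable {p c μ σ α x : ℝ}

lemma isOptimalOrder_zero_iff_of_forall_neg {q : ℝ}
    (h : ∀ q, 0 < q → criterion p c μ σ α q < 0) :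
    IsOptimalOrder p c μ σ α q ↔ q = 0 := by
  have h0 := criterion_zero_nonneg p c μ σ α
  constructor
  · rintro ⟨hq, hopt⟩
    by_contra hne
    exact absurd ((hopt 0 le_rfl).trans_lt (h q (hq.lt_of_ne' hne))) h0.not_gt
  · rintro rfl
    refine ⟨le_rfl, fun q' hq' => ?_⟩
    rcases hq'.eq_or_lt with rfl | hq'
    · exact le_rfl
    · exact (h q' hq').le.trans h0

lemma isOptimalOrder_iff_orderLevel (hc : 0 < c) (hcp : c < p) (hμ : 0 < μ) (hσ : 0 ≤ σ)
    (hα : 0 < α) (hx : 0 < x) (hxc : c * (1 + x ^ 2) = p * x ^ 2) (hv : 0 ≤ μ - σ * x) {q : ℝ} :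
    IsOptimalOrder p c μ σ α q ↔ q = orderLevel p α (μ - σ * x) (μ + σ / x) := by
  have hp := hc.trans hcp
  have hlow := huber_le_criterion_orderLevel hc hcp hσ hα hx hxc hv
  have hv₂ : μ - σ * x ≤ μ + σ / x := by
    have h1 : 0 ≤ σ / x := by positivity
    have h2 : 0 ≤ σ * x := by positivity
    linarith
  have h0 := orderLevel_nonneg hp.le hα hv hv₂
  constructor
  · rintro ⟨hq, hopt⟩
    exact eq_orderLevel_of_huber_le_criterion hc hcp hμ hσ hα hx hxc hv hq
      (hlow.trans (hopt _ h0))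
  · rintro rfl
    exact ⟨h0, fun q' _ => (criterion_le_huber hc hcp hμ hσ hα hx hxc hv q').trans hlow⟩

lemma criterion_neg_of_neg (hc : 0 < c) (hcp : c < p) (hμ : 0 < μ) (hσ : 0 ≤ σ)
    (hα : 0 ≤ α) (hxc : c * (1 + x ^ 2) = p * x ^ 2) (hv : μ - σ * x < 0) {q : ℝ}
    (hq : 0 < q) : criterion p c μ σ α q < 0 := by
  have hp := hc.trans hcp
  have hσ : 0 < σ := by
    rcases hσ.eq_or_lt with rfl | h
    · linarith
    · exact h
  -- The choice `y = μ / σ < x` puts the lower atom at `0`; the upper atom then has mass below `c /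
  -- p`, so its revenue does not cover the cost.
  have hv0 : μ - σ * (μ / σ) = 0 := by field_simp; ring
  refine (criterion_le_scarf (y := μ / σ) (ρ := 0) hp.le hμ hσ.le hα (by positivity) hv0.ge
    le_rfl).trans_lt ?_
  rw [hv0, ← EReal.coe_zero, EReal.coe_lt_coe_iff]
  have hy0 : 0 < μ / σ := by positivity
  have hyx : μ / σ < x := by rw [div_lt_iff₀ hσ]; linarith
  set y := μ / σ
  have hyx2 : y ^ 2 < x ^ 2 := by gcongr
  have hc' : c * (1 + y ^ 2) - p * y ^ 2 = (p - c) * (x ^ 2 - y ^ 2) := by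
    linear_combination hxc
  have hpos : 0 < (p - c) * (x ^ 2 - y ^ 2) := mul_pos (by linarith) (by linarith)
  have e : 1 / (1 + y ^ 2) * (p * (0 * 0) + α * (0 * 0 - 0) ^ 2) +
      (1 - 1 / (1 + y ^ 2)) * (p * q) - c * q =
      -(q * ((p - c) * (x ^ 2 - y ^ 2))) / (1 + y ^ 2) := by
    rw [← hc']
    field_simp
    ring
  rw [e]
  exact div_neg_of_neg_of_pos (neg_neg_of_pos (mul_pos hq hpos)) (by positivity)

lemma isOptimalOrder_iff (hc : 0 < c) (hcp : c < p) (hμ : 0 < μ) (hσ : 0 ≤ σ)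
    (hα : 0 ≤ α) (hx : 0 < x) (hxc : c * (1 + x ^ 2) = p * x ^ 2) {q : ℝ} :
    IsOptimalOrder p c μ σ α q ↔
      q = if 0 ≤ μ - σ * x then orderLevel p α (μ - σ * x) (μ + σ / x) else 0 := by
  split_ifs with hv
  · rcases hα.eq_or_lt with rfl | hα
    · rw [orderLevel_alpha_zero (hc.trans hcp).le]
      refine isOptimalOrder_zero_iff_of_forall_neg fun q hq => ?_
      refine (criterion_alpha_zero_le p c μ σ hq.le).trans_lt ?_
      rw [← EReal.coe_zero, EReal.coe_lt_coe_iff]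
      exact neg_neg_of_pos (mul_pos hc hq)
    · exact isOptimalOrder_iff_orderLevel hc hcp hμ hσ hα hx hxc hv
  · exact isOptimalOrder_zero_iff_of_forall_neg fun q hq =>
      criterion_neg_of_neg hc hcp hμ hσ hα hxc (not_le.1 hv) hq

lemma optimalOrder_mono {α₁ α₂ : ℝ} (hp : 0 ≤ p) (hσ : 0 ≤ σ) (hx : 0 < x) (hα : 0 ≤ α₁)
    (h : α₁ ≤ α₂) :
    (if 0 ≤ μ - σ * x then orderLevel p α₁ (μ - σ * x) (μ + σ / x) else 0) ≤
      if 0 ≤ μ - σ * x then orderLevel p α₂ (μ - σ * x) (μ + σ / x) else 0 := by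
  split_ifs with hv
  · have h1 : 0 ≤ σ / x := by positivity
    have h2 : 0 ≤ σ * x := by positivity
    exact orderLevel_mono hα h hp hv (by linarith)
  · exact le_rfl

/-! ### Agreement with the closed form -/

lemma scarfF_one_sub {κ : ℝ} (hκ : 0 < κ) (hκ1 : κ < 1) :
    scarfF (1 - κ) = (1 / √((1 - κ) / κ) - √((1 - κ) / κ)) / 2 := by
  have h1 : 0 < 1 - κ := by linarith
  set a := √(1 - κ) with ha
  set b := √κ with hb
  have ha0 : 0 < a := Real.sqrt_pos.2 h1
  have hb0 : 0 < b := Real.sqrt_pos.2 hκ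
  have ha2 : a ^ 2 = 1 - κ := Real.sq_sqrt h1.le
  have hb2 : b ^ 2 = κ := Real.sq_sqrt hκ.le
  rw [scarfF, sub_sub_cancel, Real.sqrt_div h1.le, Real.sqrt_mul h1.le, ← ha, ← hb]
  field_simp
  rw [ha2, hb2]
  ring

/-- The condition on `κ` says that the lower atom is nonnegative, and the threshold on `α` separates
the two branches of `slope`. -/
lemma closedForm_eq (hc : 0 < c) (hcp : c < p) (hμ : 0 < μ) (hσ : 0 ≤ σ) (hα : 0 ≤ α)
    (hx : x = √((1 - margin p c) / margin p c)) :
    closedForm p c μ σ α =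
      if 0 ≤ μ - σ * x then orderLevel p α (μ - σ * x) (μ + σ / x) else 0 := by
  have hp := hc.trans hcp
  have hκ : 0 < margin p c := div_pos (by linarith) hp
  have hκ1 : margin p c < 1 := by rw [margin, div_lt_one hp]; linarith
  have hx0 : 0 < x := by
    rw [hx]
    exact Real.sqrt_pos.2 (div_pos (by linarith) hκ)
  have hx2 : x ^ 2 = (1 - margin p c) / margin p c := by
    rw [hx, Real.sq_sqrt (div_nonneg (by linarith) hκ.le)]
  have hcond : σ ^ 2 / (μ ^ 2 + σ ^ 2) ≤ margin p c ↔ 0 ≤ μ - σ * x := by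
    rw [div_le_iff₀ (by positivity), sub_nonneg,
      ← sq_le_sq₀ (by positivity : 0 ≤ σ * x) hμ.le, mul_pow, hx2, ← mul_div_assoc,
      div_le_iff₀ hκ]
    constructor <;> intro h <;> linarith
  have hf := scarfF_one_sub hκ hκ1
  rw [← hx] at hf
  unfold closedForm
  simp only [hcond]
  split_ifs with hv ht
  · rw [threshold, ← hx] at ht
    -- A lower atom at `0` makes the threshold infinite, which no real `α` reaches.
    have hv0 : 0 < μ - σ * x := by
      refine hv.lt_of_ne fun h => ?_
      rw [← h, mul_zero, ENNReal.ofReal_zero, ENNReal.div_zero (by simpa using hp)] at ht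
      exact absurd ht (by simp)
    rw [ENNReal.div_le_iff (by simpa using hv0) ENNReal.ofReal_ne_top, ← ENNReal.ofReal_mul hα,
      ENNReal.ofReal_le_ofReal_iff (by positivity)] at ht
    have hα0 : 0 < α := by
      refine hα.lt_of_ne fun h => ?_
      rw [← h, zero_mul] at ht
      exact absurd ht hp.not_ge
    have hs : slope p α (μ - σ * x) = p := min_eq_left (by linarith)
    rw [orderLevel, huber, hs, hf]
    field_simp
    ring
  · rw [threshold, ← hx] at ht
    have hs : slope p α (μ - σ * x) = 2 * α * (μ - σ * x) := by
      refine min_eq_right (not_lt.1 fun h => ht ?_)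
      have hv0 : 0 < μ - σ * x := by
        refine hv.lt_of_ne fun h0 => ?_
        rw [← h0, mul_zero] at h
        exact absurd h hp.not_gt
      rw [ENNReal.div_le_iff (by simpa using hv0) ENNReal.ofReal_ne_top,
        ← ENNReal.ofReal_mul hα]
      exact ENNReal.ofReal_le_ofReal (by linarith)
    rcases hα.eq_or_lt with rfl | hα
    · rw [orderLevel_alpha_zero hp.le]
      simp
    · rw [orderLevel, huber, hs, hf]
      field_simp
      ring
  · rfl

end

end Newsvendor

theorem theorem2 (p c μ σ : ℝ) (hc : 0 < c) (hcp : c < p) (hμ : 0 < μ) (hσ : 0 ≤ σ) :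
    (∀ α : ℝ, 0 ≤ α → ∀ q : ℝ,
      Newsvendor.IsOptimalOrder p c μ σ α q ↔ q = Newsvendor.closedForm p c μ σ α) ∧
    (∀ α₁ α₂ q₁ q₂ : ℝ, 0 ≤ α₁ → α₁ ≤ α₂ →
      Newsvendor.IsOptimalOrder p c μ σ α₁ q₁ → Newsvendor.IsOptimalOrder p c μ σ α₂ q₂ →
      q₁ ≤ q₂) := by
  have hp := hc.trans hcp
  have hκ : 0 < Newsvendor.margin p c := div_pos (by linarith) hp
  have hκ1 : (1 - Newsvendor.margin p c) / Newsvendor.margin p c = c / (p - c) := by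
    have : p - c ≠ 0 := by linarith
    rw [Newsvendor.margin]
    field_simp
    ring
  obtain ⟨x, hx⟩ : ∃ x, x = √((1 - Newsvendor.margin p c) / Newsvendor.margin p c) := ⟨_, rfl⟩
  have hpos : 0 < c / (p - c) := div_pos hc (by linarith)
  have hx0 : 0 < x := by rw [hx, hκ1]; exact Real.sqrt_pos.2 hpos
  have hxc : c * (1 + x ^ 2) = p * x ^ 2 := by
    have : p - c ≠ 0 := by linarith
    rw [hx, hκ1, Real.sq_sqrt hpos.le]
    field_simp
    ring
  refine ⟨fun α hα q => ?_, fun α₁ α₂ q₁ q₂ hα h h₁ h₂ => ?_⟩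
  · rw [Newsvendor.closedForm_eq hc hcp hμ hσ hα hx]
    exact Newsvendor.isOptimalOrder_iff hc hcp hμ hσ hα hx0 hxc
  · rw [Newsvendor.isOptimalOrder_iff hc hcp hμ hσ hα hx0 hxc] at h₁
    rw [Newsvendor.isOptimalOrder_iff hc hcp hμ hσ (hα.trans h) hx0 hxc] at h₂
    rw [h₁, h₂]
    exact Newsvendor.optimalOrder_mono hp.le hσ hx0 hα h
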